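/- Let $\mathbb{F}_q$ be a finite field and let $C$ be an $[n,k]$ code over $\mathbb{F}_q$, that is, a $k$-dimensional subspace of $\mathbb{F}_q^n$. Let $C^\perp$ be its dual code with respect to the standard inner product, assume $C^\perp\neq\{\mathbf 0\}$, and let $d^\perp$ be the minimum Hamming weight of the nonzero vectors of $C^\perp$. For a subspace $D\subseteq\mathbb{F}_q^n$ let $\mathrm{Supp}(D)$ be the set of coordinates $i$ with $x_i\neq 0$ for some $x\in D$. The covering dimension $\gamma(C)$ is $\infty$ if $\mathrm{Supp}(C)\neq\{1,\dots,n\}$, and otherwise it is the least positive integer $r$ such that $C$ has an $r$-dimensional subspace $D$ with $\mathrm{Supp}(D)=\{1,\dots,n\}$. A dual Hamming code is a code with a $k\times n$ generator matrix whose columns are nonzero and contain exactly one multiple of each nonzero vector of $\mathbb{F}_q^k$; two codes in $\mathbb{F}_q^n$ are isomorphic if a permutation of the coordinates together with a scaling of each coordinate by a nonzero element of $\mathbb{F}_q$ carries one onto the other. Suppose that $d^\perp\geq 3$, and that it is not the case that both $d^\perp>4$ and $q=2^m$ for some integer $m\geq 2$. Then \[ \gamma(C)\leq k-d^\perp+2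 \] unless $C$ is isomorphic to a dual Hamming code, or $q=2$, $k=n-1$ and $d^\perp=n$ is odd; in either of these two exceptional cases \[ \gamma(C)=k-d^\perp+3 . \] -/

import Mathlib

open Module

namespace LinCode

variable {F : Type*} [Field F] {n : ℕ}

/-- The support of a set of vectors: the union of the supports of its members. -/
def supp (B : Set (Fin n → F)) : Set (Fin n) :=
  ⋃ x ∈ B, Function.support x

/-- The weight of a set of vectors: the size of its support. -/
noncomputable def wt (B : Set (Fin n → F)) : ℕ :=
  (supp B).ncard

/-- The dual code, with respect to the standard inner product. -/
def dual (C : Submodule F (Fin n → F)) : Submodule F (Fin n → F) where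
  carrier := {y | ∀ x ∈ C, x ⬝ᵥ y = 0}
  zero_mem' := fun x _ => dotProduct_zero x
  add_mem' := fun {a b} ha hb x hx => by
    rw [dotProduct_add, ha x hx, hb x hx, add_zero]
  smul_mem' := fun c y hy x hx => by
    rw [dotProduct_smul, hy x hx, smul_zero]

open Classical in
/-- The minimum Hamming weight of the nonzero codewords. For the zero code, where the minimum
is over the empty set, this returns `0`. -/
noncomputable def minWeight (C : Submodule F (Fin n → F)) : ℕ :=
  sInf {w | ∃ x ∈ C, x ≠ 0 ∧ hammingNorm x = w}

/-- `A_i^{(r)}(C)`: the number of `r`-dimensional subcodes of `C` of weight `i`. -/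
noncomputable def numSubcodes (C : Submodule F (Fin n → F)) (r i : ℕ) : ℕ :=
  Nat.card {D : Submodule F (Fin n → F) //
    D ≤ C ∧ finrank F D = r ∧ wt (D : Set (Fin n → F)) = i}

open Classical in
/-- The covering dimension: `∞` if some coordinate vanishes on all of `C`, and otherwise the least
positive `r` such that `C` has an `r`-dimensional subcode of weight `n`. -/
noncomputable def coveringDim (C : Submodule F (Fin n → F)) : ℕ∞ :=
  if supp (C : Set (Fin n → F)) = Set.univ then
    ⨅ r : {r : ℕ // 0 < r ∧ numSubcodes C r n ≠ 0}, ((r : ℕ) : ℕ∞)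
  else ⊤

/-- `G` is a generator matrix of `C`: its rows form a basis of `C`. -/
def IsGeneratorMatrix {k : ℕ} (G : Matrix (Fin k) (Fin n) F)
    (C : Submodule F (Fin n → F)) : Prop :=
  LinearIndependent F G.row ∧ Submodule.span F (Set.range G.row) = C

/-- A dual Hamming code: it has a generator matrix with nonzero columns that contain exactly one
(nonzero) multiple of each nonzero vector of `F ^ k`. -/
def IsDualHamming (C : Submodule F (Fin n → F)) : Prop :=
  ∃ (k : ℕ) (G : Matrix (Fin k) (Fin n) F), IsGeneratorMatrix G C ∧
    (∀ j, G.col j ≠ 0) ∧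
    ∀ v : Fin k → F, v ≠ 0 → ∃! j, ∃ c : F, c ≠ 0 ∧ G.col j = c • v

/-- Isomorphism of linear codes: a permutation of the coordinates combined with the scaling of
each coordinate by a nonzero element carries one code onto the other. -/
def Isomorphic (C D : Submodule F (Fin n → F)) : Prop :=
  ∃ (σ : Equiv.Perm (Fin n)) (c : Fin n → Fˣ),
    ∀ x : Fin n → F, x ∈ C ↔ (fun i => (c i : F) * x (σ i)) ∈ D

/-- The two exceptional classes: codes isomorphic to a dual Hamming code, and binary
`[n, n-1]` codes whose dual has minimum weight `n`, with `n` odd. -/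
def IsExceptional (C : Submodule F (Fin n → F)) : Prop :=
  (∃ D : Submodule F (Fin n → F), IsDualHamming D ∧ Isomorphic C D) ∨
    (Nat.card F = 2 ∧ finrank F C + 1 = n ∧ minWeight (dual C) = n ∧ Odd n)

end LinCode

/-!
Fix a generator matrix of `C` and let `d` be the dual distance: any `d - 1` columns are linearly
independent, so codewords take arbitrary values on any `t = d - 1` coordinates
(`LinCode.interpolate`).

For `d ≥ 4`, choose a set `T` of `t` coordinates, with closure `N`: the coordinates at which
every word vanishing on `T` vanishes. The words vanishing on `T` form a subcode of dimension
`k - t`, and for each coordinate outside `N` one of them is nonzero there. Adjoining one word of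
`C` without zeros in `N` gives a covering subcode of dimension at most `k - d + 2`
(`LinCode.exists_covers_of_closure`). Restricted to `N`, the code is MDS of dimension `t`, so the
question is whether an MDS code has a word of full weight.

The length of such a code is at most `q + t - 1` (`LinCode.IsMDS.card_lt`). Let `x₁` vanish on
exactly `t - 1` coordinates and let `x₀` be nonzero on all of these. A word `x₀ + c • x₁` has a
zero only if `c` is one of the ratios `-x₀ j / x₁ j` at the other coordinates `j`. There are at
most `q` of those, and a coefficient `c` is left over as soon as two ratios agree. This can be
arranged, provided that `t - 1` nonzero scalars with sum zero exist, that is, unless `q = 2` and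
`t` is even (`LinCode.IsMDS.exists_forall_ne_zero`). This works over every finite field. If
`q = 2` and `d = t + 1` is odd, then either `n = d`, which forces `k = n - 1` and is exceptional,
or some `T` equals its own closure and the all-ones word on `T` extends
(`LinCode.exists_closed_of_card_eq_two`).

For `d = 3`, the columns are distinct points of the projective space of dimension `k - 1`. If a
point is missed, the corresponding hyperplane of `C` covers all coordinates; otherwise `C` is a
dual Hamming code, and no proper subcode covers all coordinates
(`LinCode.isDualHamming_or_exists_covers`, `LinCode.IsDualHamming.minWeight_and_covers`). In the
other exceptional class, `C` is the even weight code of odd length, of covering dimension two.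
-/

namespace LinCode

/-! ### Covering subcodes -/

section Covering

variable {F : Type*} [Field F] {n : ℕ}

/-- No coordinate vanishes identically on `D`. -/
def Covers (D : Submodule F (Fin n → F)) : Prop :=
  ∀ i, ∃ x ∈ D, x i ≠ 0

lemma supp_eq_univ_iff {D : Submodule F (Fin n → F)} :
    supp (D : Set (Fin n → F)) = Set.univ ↔ Covers D := by
  simp [supp, Covers, Set.eq_univ_iff_forall]

lemma wt_eq_iff {D : Submodule F (Fin n → F)} :
    wt (D : Set (Fin n → F)) = n ↔ Covers D := by
  rw [← supp_eq_univ_iff, Set.eq_univ_iff_ncard, Nat.card_eq_fintype_card, Fintype.card_fin, wt]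

lemma numSubcodes_ne_zero_iff [Finite F] {C : Submodule F (Fin n → F)} {r : ℕ} :
    numSubcodes C r n ≠ 0 ↔ ∃ D ≤ C, finrank F D = r ∧ Covers D := by
  have : Finite (Submodule F (Fin n → F)) :=
    Finite.of_injective (fun D => (D : Set (Fin n → F))) SetLike.coe_injective
  rw [numSubcodes, ← Nat.pos_iff_ne_zero, Nat.card_pos_iff]
  simp only [wt_eq_iff]
  constructor
  · rintro ⟨⟨D, h1, h2, h3⟩, -⟩
    exact ⟨D, h1, h2, h3⟩
  · rintro ⟨D, h1, h2, h3⟩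
    exact ⟨⟨D, h1, h2, h3⟩, inferInstance⟩

lemma Covers.finrank_pos {D : Submodule F (Fin n → F)} (h : Covers D) (hn : 0 < n) :
    0 < finrank F D := by
  obtain ⟨x, hx, hxi⟩ := h ⟨0, hn⟩
  have : Nontrivial D := ⟨⟨x, hx⟩, 0, fun h =>
    hxi (congrFun (congrArg Subtype.val h) _)⟩
  exact Module.finrank_pos

/-- The covering dimension is the dimension of a smallest covering subcode. -/
lemma Covers.exists_coveringDim_eq [Finite F] {C D : Submodule F (Fin n → F)} (hn : 0 < n)
    (hD : Covers D) (hDC : D ≤ C) :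
    ∃ D' ≤ C, Covers D' ∧ coveringDim C = (finrank F D' : ℕ) ∧ finrank F D' ≤ finrank F D := by
  classical
  have hex : ∃ r, ∃ D ≤ C, finrank F D = r ∧ Covers D := ⟨_, D, hDC, rfl, hD⟩
  obtain ⟨D', h1, h2, h3⟩ := Nat.find_spec hex
  refine ⟨D', h1, h3, ?_, ?_⟩
  · have hC : Covers C := fun i => (hD i).imp fun x hx => ⟨hDC hx.1, hx.2⟩
    rw [coveringDim, if_pos (supp_eq_univ_iff.2 hC)]
    refine le_antisymm (iInf_le_of_le ⟨finrank F D', h3.finrank_pos hn,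
      numSubcodes_ne_zero_iff.2 ⟨D', h1, rfl, h3⟩⟩ le_rfl) (le_iInf fun r => ?_)
    rw [h2]
    exact_mod_cast Nat.find_min' hex (numSubcodes_ne_zero_iff.1 r.2.2)
  · rw [h2]
    exact Nat.find_min' hex ⟨D, hDC, rfl, hD⟩

end Covering

/-! ### Interpolation by codewords -/

section Interpolation

variable {F : Type*} [Field F] {n : ℕ}

/-- Either the words of `C` take arbitrary values on the coordinate set `T`, or `T` supports a
nonzero dual word. -/
lemma interpolate_or_exists_dual (C : Submodule F (Fin n → F)) (T : Finset (Fin n)) :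
    (∀ z : Fin n → F, ∃ x ∈ C, ∀ i ∈ T, x i = z i) ∨
      ∃ g ∈ dual C, g ≠ 0 ∧ ∀ i, i ∉ T → g i = 0 := by
  classical
  let ρ : (Fin n → F) →ₗ[F] (T → F) := LinearMap.funLeft F F Subtype.val
  by_cases h : C.map ρ = ⊤
  · left
    intro z
    obtain ⟨x, hx, hxz⟩ : ρ z ∈ C.map ρ := h ▸ Submodule.mem_top
    exact ⟨x, hx, fun i hi => congrFun hxz ⟨i, hi⟩⟩
  · right
    obtain ⟨φ, hφ, hle⟩ := Submodule.exists_le_ker_of_lt_top _ (lt_top_iff_ne_top.2 h)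
    let g : Fin n → F := fun i => if hi : i ∈ T then φ (Pi.single ⟨i, hi⟩ 1) else 0
    have hdot : ∀ x, x ⬝ᵥ g = φ (ρ x) := by
      intro x
      rw [LinearMap.pi_apply_eq_sum_univ φ (ρ x), dotProduct,
        ← Finset.sum_subset (Finset.subset_univ T), ← Finset.sum_coe_sort T]
      · refine Finset.sum_congr rfl fun i _ => ?_
        simp only [g, i.2, dif_pos, smul_eq_mul, ρ, LinearMap.funLeft_apply]
        congr 2
        ext j
        simp [Pi.single_apply, eq_comm]
      · intro i _ hi
        simp [g, hi]
    refine ⟨g, fun x hx => ?_, ?_, fun i hi => by simp [g, hi]⟩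
    · rw [hdot]
      exact hle (Submodule.mem_map_of_mem hx)
    · rintro hg
      apply hφ
      ext i
      have := congrFun hg i
      simpa [g] using this

open Classical in
lemma hammingNorm_le_card {g : Fin n → F} {T : Finset (Fin n)}
    (h : ∀ i, i ∉ T → g i = 0) : hammingNorm g ≤ T.card := by
  refine Finset.card_le_card fun i hi => ?_
  by_contra hiT
  exact (Finset.mem_filter.1 hi).2 (h i hiT)

open Classical in
lemma minWeight_le {C : Submodule F (Fin n → F)} {x : Fin n → F} (hx : x ∈ C) (h0 : x ≠ 0) :
    minWeight C ≤ hammingNorm x :=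
  Nat.sInf_le ⟨x, hx, h0, rfl⟩

open Classical in
lemma exists_hammingNorm_eq_minWeight {C : Submodule F (Fin n → F)} (h : 0 < minWeight C) :
    ∃ x ∈ C, x ≠ 0 ∧ hammingNorm x = minWeight C :=
  Nat.sInf_mem (Nat.nonempty_of_pos_sInf h)

/-- A set that is too small to support a dual word is a set on which codewords interpolate. -/
lemma interpolate {C : Submodule F (Fin n → F)} {T : Finset (Fin n)}
    (hT : T.card < minWeight (dual C)) (z : Fin n → F) : ∃ x ∈ C, ∀ i ∈ T, x i = z i := by
  rcases interpolate_or_exists_dual C T with h | ⟨g, hg, hg0, hgT⟩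
  · exact h z
  · exact absurd ((minWeight_le hg hg0).trans (hammingNorm_le_card hgT)) (by omega)

end Interpolation

/-! ### Nonzero elements with sum zero -/

section Field

variable {F : Type*} [Field F] {ι : Type*}

/-- Over a field with more than two elements, every nonzero element is a sum of a prescribed
positive number of nonzero elements. -/
lemma exists_sum_eq_of_ne_zero [Finite F] (hq : 2 < Nat.card F) {s : Finset ι}
    (hs : s.Nonempty) {y : F} (hy : y ≠ 0) : ∃ a : ι → F, (∀ i, a i ≠ 0) ∧ ∑ i ∈ s, a i = y := by
  classical
  have := Fintype.ofFinite F
  induction hs using Finset.Nonempty.cons_induction generalizing y with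
  | singleton i => exact ⟨fun _ => y, fun _ => hy, by simp⟩
  | cons i s hi hs ih =>
    obtain ⟨b, hb⟩ : ∃ b, b ∉ ({0, y} : Finset F) := by
      by_contra! h
      have h1 := Finset.card_le_card (fun j _ => h j : (Finset.univ : Finset F) ⊆ {0, y})
      have h2 := Finset.card_le_two (a := (0 : F)) (b := y)
      rw [Finset.card_univ, ← Nat.card_eq_fintype_card] at h1
      omega
    simp only [Finset.mem_insert, Finset.mem_singleton, not_or] at hb
    obtain ⟨a, ha, hsum⟩ := ih (y := y - b) (sub_ne_zero.2 (Ne.symm hb.2))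
    refine ⟨Function.update a i b, fun j => ?_, ?_⟩
    · by_cases hji : j = i
      · subst hji; simpa using hb.1
      · simpa [hji] using ha j
    · rw [Finset.sum_cons, Function.update_self, Finset.sum_update_of_notMem hi, hsum]
      ring

lemma eq_one_of_card_eq_two (hq : Nat.card F = 2) {a : F} (ha : a ≠ 0) : a = 1 := by
  by_contra h
  have : Finite F := Nat.finite_of_card_ne_zero (by omega)
  have := Fintype.ofFinite F
  classical
  have h1 : ({0, 1, a} : Finset F).card ≤ Fintype.card F := Finset.card_le_univ _
  rw [Finset.card_eq_three.2 ⟨0, 1, a, zero_ne_one, Ne.symm ha, Ne.symm h, rfl⟩,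
    ← Nat.card_eq_fintype_card] at h1
  omega

lemma natCast_eq_zero_of_even (hq : Nat.card F = 2) {m : ℕ} (hm : Even m) : (m : F) = 0 := by
  have h2 : (1 : F) + 1 = 0 := by
    by_contra h
    simpa using eq_one_of_card_eq_two hq h
  obtain ⟨l, rfl⟩ := hm
  rw [Nat.cast_add, ← mul_two, ← one_add_one_eq_two, h2, mul_zero]

/-- Nonzero elements with sum zero. -/
lemma exists_sum_eq_zero [Finite F] {s : Finset ι} (hs : 2 ≤ s.card)
    (h : Nat.card F ≠ 2 ∨ Even s.card) : ∃ a : ι → F, (∀ i, a i ≠ 0) ∧ ∑ i ∈ s, a i = 0 := by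
  classical
  by_cases hq : Nat.card F = 2
  · exact ⟨fun _ => 1, fun _ => one_ne_zero, by
      simpa using natCast_eq_zero_of_even hq (h.resolve_left (by simp [hq]))⟩
  · have hq' : 2 < Nat.card F := lt_of_le_of_ne (Finite.one_lt_card (α := F)) (Ne.symm hq)
    obtain ⟨i, hi⟩ : s.Nonempty := Finset.card_pos.1 (by omega)
    obtain ⟨a, ha, hsum⟩ := exists_sum_eq_of_ne_zero hq' (s := s.erase i)
      (Finset.card_pos.1 (by rw [Finset.card_erase_of_mem hi]; omega))
      (y := (-1 : F)) (by simp)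
    refine ⟨Function.update a i 1, fun j => ?_, ?_⟩
    · by_cases hji : j = i
      · subst hji; simp
      · simpa [hji] using ha j
    · rw [← Finset.add_sum_erase s _ hi, Finset.sum_update_of_notMem (Finset.notMem_erase i s),
        hsum]
      simp

end Field

/-! ### Words of full weight in MDS codes -/

section MDS

variable {F : Type*} [Field F] {ι : Type*} [Fintype ι]

/-- A code of dimension at most `t` in which every `t` coordinates can be prescribed
arbitrarily, that is, an MDS code of dimension `t` (when the length is at least `t`). -/
structure IsMDS (M : Submodule F (ι → F)) (t : ℕ) : Prop where
  finrank_le : finrank F M ≤ t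
  interpolate : ∀ T : Finset ι, T.card ≤ t → ∀ z : ι → F, ∃ x ∈ M, ∀ i ∈ T, x i = z i

variable {M : Submodule F (ι → F)} {t : ℕ}

lemma IsMDS.eq_zero (hM : IsMDS M t) {T : Finset ι} (hT : T.card = t) {x : ι → F}
    (hx : x ∈ M) (h : ∀ i ∈ T, x i = 0) : x = 0 := by
  let ρ : M →ₗ[F] (T → F) := (LinearMap.funLeft F F Subtype.val).comp M.subtype
  have hsurj : Function.Surjective ρ := by
    classical
    intro z
    obtain ⟨y, hy, hyz⟩ := hM.interpolate T hT.le (fun i => if hi : i ∈ T then z ⟨i, hi⟩ else 0)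
    refine ⟨⟨y, hy⟩, ?_⟩
    ext i
    simpa [ρ] using hyz i i.2
  have hrank : finrank F M = finrank F (T → F) := by
    refine le_antisymm ?_ ?_
    · simpa [hT] using hM.finrank_le
    · have := LinearMap.finrank_range_le ρ
      rwa [LinearMap.range_eq_top.2 hsurj, finrank_top] at this
  have hinj := (LinearMap.injective_iff_surjective_of_finrank_eq_finrank hrank).2 hsurj
  have : (⟨x, hx⟩ : M) = 0 := hinj (by ext i; simpa [ρ] using h i i.2)
  simpa using congrArg Subtype.val this

lemma IsMDS.ne_zero_of_notMem [DecidableEq ι] (hM : IsMDS M t) {s : Finset ι}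
    (hs : s.card + 1 = t) {x : ι → F} (hx : x ∈ M) (h0 : x ≠ 0) (h : ∀ i ∈ s, x i = 0)
    {j : ι} (hj : j ∉ s) : x j ≠ 0 := by
  intro hxj
  refine h0 (hM.eq_zero (T := insert j s) (by rw [Finset.card_insert_of_notMem hj, hs]) hx ?_)
  simpa [hxj] using h

/-- The length of an MDS code of dimension `t ≥ 2` is at most `q + t - 1`. The pencil spanned by
a word `x₁` vanishing on `t - 1` coordinates and a word `x₀` vanishing on all but one of them
separates the other coordinates by the ratio of the two words. -/
lemma IsMDS.card_lt [Finite F] (hM : IsMDS M t) (ht : 2 ≤ t) :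
    Fintype.card ι < Nat.card F + t := by
  classical
  have := Fintype.ofFinite F
  by_contra! hcard
  obtain ⟨s, -, hs⟩ := Finset.exists_subset_card_eq (s := (Finset.univ : Finset ι)) (n := t - 1)
    (by rw [Finset.card_univ]; omega)
  obtain ⟨i₀, hi₀⟩ : s.Nonempty := Finset.card_pos.1 (by omega)
  obtain ⟨j₀, hj₀⟩ : ∃ j, j ∉ s := by
    by_contra! h
    have := Finset.card_le_card (fun j _ => h j : (Finset.univ : Finset ι) ⊆ s)
    rw [Finset.card_univ] at this
    omega
  obtain ⟨x₀, hx₀, hx₀s⟩ := hM.interpolate s (by omega) (Pi.single i₀ 1)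
  obtain ⟨x₁, hx₁, hx₁s⟩ := hM.interpolate (insert j₀ s)
    (by rw [Finset.card_insert_of_notMem hj₀]; omega) (Pi.single j₀ 1)
  have hx₁j₀ : x₁ j₀ = 1 := by simpa using hx₁s j₀ (by simp)
  have hx₁0 : ∀ i ∈ s, x₁ i = 0 := fun i hi => by
    rw [hx₁s i (by simp [hi]), Pi.single_eq_of_ne (ne_of_mem_of_not_mem hi hj₀)]
  have hx₁ne : ∀ j ∉ s, x₁ j ≠ 0 := fun j hj => hM.ne_zero_of_notMem (by omega) hx₁
    (fun h => by simp [h] at hx₁j₀) hx₁0 hj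
  have hle : (sᶜ).card ≤ Fintype.card F := by
    refine Finset.card_le_card_of_injOn (fun j => x₀ j / x₁ j) (fun _ _ => Finset.mem_univ _) ?_
    intro j hj j' hj' hjj'
    simp only [Finset.coe_compl, Set.mem_compl_iff, Finset.mem_coe] at hj hj'
    by_contra hne
    -- Equal ratios give a word of the pencil with `t` zeros that does not vanish at `i₀`.
    have hz : x₀ - (x₀ j / x₁ j) • x₁ = 0 := by
      refine hM.eq_zero (T := insert j (insert j' (s.erase i₀))) ?_
        (M.sub_mem hx₀ (M.smul_mem _ hx₁)) ?_
      · rw [Finset.card_insert_of_notMem (by simp [hne, hj]),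
          Finset.card_insert_of_notMem (by simp [hj']), Finset.card_erase_of_mem hi₀]
        omega
      · intro i hi
        simp only [Finset.mem_insert, Finset.mem_erase] at hi
        rcases hi with rfl | rfl | ⟨h1, h2⟩
        · simp [hx₁ne _ hj]
        · simp only at hjj'
          simp [hjj', hx₁ne _ hj']
        · simp [hx₁0 i h2, hx₀s i h2, h1]
    have := congrFun hz i₀
    simp [hx₁0 i₀ hi₀, hx₀s i₀ hi₀] at this
  rw [Finset.card_compl, ← Nat.card_eq_fintype_card (α := F)] at hle
  omega

/-- An MDS code of dimension `t ≥ 3` has a word of full weight, except possibly if it is binary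
and `t` is even. -/
lemma IsMDS.exists_forall_ne_zero [Finite F] (hM : IsMDS M t) (ht : 3 ≤ t)
    (h : Nat.card F ≠ 2 ∨ Odd t) : ∃ x ∈ M, ∀ i, x i ≠ 0 := by
  classical
  have := Fintype.ofFinite F
  by_cases hcard : Fintype.card ι ≤ t
  · obtain ⟨x, hx, hx1⟩ := hM.interpolate Finset.univ (by rwa [Finset.card_univ]) 1
    exact ⟨x, hx, fun i => by simp [hx1 i (Finset.mem_univ i)]⟩
  obtain ⟨s', -, hs'⟩ := Finset.exists_subset_card_eq (s := (Finset.univ : Finset ι))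
    (n := t + 1) (by rw [Finset.card_univ]; omega)
  obtain ⟨j, hj⟩ : s'.Nonempty := Finset.card_pos.1 (by omega)
  obtain ⟨T, hT⟩ : ∃ T, T = s'.erase j := ⟨_, rfl⟩
  have hTc : T.card = t := by rw [hT, Finset.card_erase_of_mem hj]; omega
  have hjT : j ∉ T := by simp [hT]
  obtain ⟨j', hj'⟩ : T.Nonempty := Finset.card_pos.1 (by omega)
  obtain ⟨s, hs⟩ : ∃ s, s = T.erase j' := ⟨_, rfl⟩
  have hsc : s.card + 1 = t := by rw [hs, Finset.card_erase_of_mem hj']; omega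
  have hj's : j' ∉ s := by simp [hs]
  have hsT : s ⊆ T := hs ▸ Finset.erase_subset _ _
  have hjs : j ∉ s := fun h => hjT (hsT h)
  have hjj' : j' ≠ j := fun h => hjT (h ▸ hj')
  have hunit : ∀ i, ∃ u ∈ M, ∀ l ∈ T, u l = (Pi.single i 1 : ι → F) l :=
    fun i => hM.interpolate T hTc.le _
  choose u hu hui using hunit
  have huj : ∀ i ∈ T, u i j ≠ 0 := by
    intro i hi
    refine hM.ne_zero_of_notMem (s := T.erase i) ?_ (hu i) (fun h0 => ?_) ?_ (by simp [hjT])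
    · rw [Finset.card_erase_of_mem hi]; omega
    · simpa [h0] using hui i i hi
    · intro l hl
      rw [hui i l (Finset.mem_of_mem_erase hl), Pi.single_eq_of_ne (Finset.ne_of_mem_erase hl)]
  obtain ⟨a, ha, hsum⟩ := exists_sum_eq_zero (F := F) (s := s) (by omega)
    (h.imp_right fun ho => by
      rw [← hsc] at ho
      exact Nat.not_odd_iff_even.1 (Nat.odd_add_one.1 ho))
  -- `x₀` has no zero on `s` but vanishes at both `j` and `j'`; `u j'` vanishes exactly on `s`.
  obtain ⟨x₀, hx₀⟩ : ∃ x₀, x₀ = ∑ i ∈ s, (a i / u i j) • u i := ⟨_, rfl⟩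
  have hx₀M : x₀ ∈ M := hx₀ ▸ M.sum_mem fun i _ => M.smul_mem _ (hu i)
  have hx₀j : x₀ j = 0 := by
    rw [hx₀, Finset.sum_apply, ← hsum]
    exact Finset.sum_congr rfl fun i hi => by simp [huj i (hsT hi)]
  have hx₀j' : x₀ j' = 0 := by
    rw [hx₀, Finset.sum_apply]
    refine Finset.sum_eq_zero fun i hi => ?_
    rw [Pi.smul_apply, hui i j' hj', Pi.single_eq_of_ne (ne_of_mem_of_not_mem hi hj's).symm,
      smul_zero]
  have hx₀s : ∀ i ∈ s, x₀ i ≠ 0 := by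
    intro i hi
    have : x₀ i = a i / u i j := by
      rw [hx₀, Finset.sum_apply, Finset.sum_eq_single i]
      · simp [hui i i (hsT hi)]
      · intro l _ hli
        rw [Pi.smul_apply, hui l i (hsT hi), Pi.single_eq_of_ne (Ne.symm hli), smul_zero]
      · exact fun h => absurd hi h
    rw [this]
    exact div_ne_zero (ha i) (huj i (hsT hi))
  have hx₁s : ∀ i ∈ s, u j' i = 0 := fun i hi => by
    rw [hui j' i (hsT hi), Pi.single_eq_of_ne (ne_of_mem_of_not_mem hi hj's)]
  have hx₁ : ∀ i ∉ s, u j' i ≠ 0 := fun i hi => by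
    refine hM.ne_zero_of_notMem hsc (hu j') (fun h0 => ?_) hx₁s hi
    simpa [h0] using hui j' j' hj'
  -- The excluded `c` are those for which `x₀ + c • u j'` has a zero off `s`. Both `j` and `j'`
  -- exclude only `c = 0`, so fewer than `q` values are excluded.
  obtain ⟨c, hc⟩ : ∃ c, c ∉ ((sᶜ).erase j).image fun i => -x₀ i / u j' i := by
    by_contra! hall
    have h1 := Finset.card_le_card (fun c _ => hall c : (Finset.univ : Finset F) ⊆ _)
    have h2 := h1.trans Finset.card_image_le
    rw [Finset.card_erase_of_mem (by simpa using hjs), Finset.card_compl, Finset.card_univ,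
      ← Nat.card_eq_fintype_card] at h2
    have := hM.card_lt (by omega)
    omega
  have hc' : ∀ i ∉ s, -x₀ i / u j' i ≠ c := by
    intro i hi hic
    by_cases hij : i = j
    · refine hc (Finset.mem_image.2 ⟨j', by simp [hj's, hjj'], ?_⟩)
      rw [← hic, hij, hx₀j, hx₀j']
      simp
    · exact hc (Finset.mem_image.2 ⟨i, by simp [hi, hij], hic⟩)
  refine ⟨x₀ + c • u j', M.add_mem hx₀M (M.smul_mem _ (hu j')), fun i hi0 => ?_⟩
  by_cases hi : i ∈ s
  · exact hx₀s i hi (by simpa [hx₁s i hi] using hi0)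
  · refine hc' i hi ?_
    rw [div_eq_iff (hx₁ i hi)]
    simp only [Pi.add_apply, Pi.smul_apply, smul_eq_mul] at hi0
    linear_combination -hi0

end MDS

/-! ### Codes whose dual distance is at least four -/

section Large

variable {F : Type*} [Field F] {n : ℕ} {C : Submodule F (Fin n → F)}

/-- The restriction of the words of `C` to the coordinates satisfying `p`. -/
def restrict (C : Submodule F (Fin n → F)) (p : Fin n → Prop) : C →ₗ[F] ({i // p i} → F) :=
  (LinearMap.funLeft F F Subtype.val).comp C.subtype

@[simp]
lemma restrict_apply (p : Fin n → Prop) (x : C) (i : {i // p i}) :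
    restrict C p x i = (x : Fin n → F) i := rfl

lemma range_restrict {T : Finset (Fin n)} (hT : T.card < minWeight (dual C)) :
    LinearMap.range (restrict C (· ∈ T)) = ⊤ := by
  classical
  refine LinearMap.range_eq_top.2 fun z => ?_
  obtain ⟨x, hx, hxz⟩ := interpolate hT fun i => if hi : i ∈ T then z ⟨i, hi⟩ else 0
  refine ⟨⟨x, hx⟩, ?_⟩
  ext i
  simpa using hxz i i.2

lemma finrank_ker_restrict {T : Finset (Fin n)} (hT : T.card < minWeight (dual C)) :
    T.card + finrank F (LinearMap.ker (restrict C (· ∈ T))) = finrank F C := by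
  rw [← LinearMap.finrank_range_add_finrank_ker (restrict C (· ∈ T)), range_restrict hT,
    finrank_top]
  simp

/-- Coordinate `i` is determined by the coordinates in `T`: the words of `C` vanishing on `T`
vanish at `i`. In matroid terms, `i` lies in the closure of `T`. -/
def InClosure (C : Submodule F (Fin n → F)) (T : Finset (Fin n)) (i : Fin n) : Prop :=
  ∀ y ∈ C, (∀ j ∈ T, y j = 0) → y i = 0

/-- The words vanishing on `T`, together with one word that has no zero in the closure of `T`,
generate a covering subcode. -/
lemma exists_covers_of_closure {T : Finset (Fin n)} (hT : T.card < minWeight (dual C))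
    {x : Fin n → F} (hx : x ∈ C) (hxT : ∀ i, InClosure C T i → x i ≠ 0) :
    ∃ D ≤ C, Covers D ∧ finrank F D + T.card ≤ finrank F C + 1 := by
  let K := (LinearMap.ker (restrict C (· ∈ T))).map C.subtype
  refine ⟨K ⊔ Submodule.span F {x}, sup_le ?_ ?_, fun i => ?_, ?_⟩
  · exact Submodule.map_subtype_le _ _
  · simpa using hx
  · by_cases hi : InClosure C T i
    · exact ⟨x, Submodule.mem_sup_right (Submodule.mem_span_singleton_self x), hxT i hi⟩
    · unfold InClosure at hi
      push Not at hi
      obtain ⟨y, hy, hyT, hyi⟩ := hi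
      refine ⟨y, Submodule.mem_sup_left ⟨⟨y, hy⟩, ?_, rfl⟩, hyi⟩
      ext j
      exact hyT j j.2
  · have h1 := Submodule.finrank_add_le_finrank_add_finrank K (Submodule.span F {x})
    have h2 : finrank F (Submodule.span F {x}) ≤ 1 := by
      simpa using finrank_span_le_card (R := F) ({x} : Set (Fin n → F))
    have h3 : finrank F K ≤ _ := Submodule.finrank_map_le _ _
    have h4 := finrank_ker_restrict hT
    omega

/-- A code restricted to the closure of fewer coordinates than its dual distance is MDS. -/
lemma isMDS_range_restrict {T : Finset (Fin n)} (hT : T.card < minWeight (dual C)) :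
    IsMDS (LinearMap.range (restrict C (InClosure C T))) T.card where
  finrank_le := by
    have hker : LinearMap.ker (restrict C (· ∈ T)) ≤
        LinearMap.ker (restrict C (InClosure C T)) := by
      intro y hy
      ext i
      exact i.2 y y.2 fun j hj => congrFun hy ⟨j, hj⟩
    have h1 := Submodule.finrank_mono hker
    have h2 := finrank_ker_restrict hT
    have h3 := LinearMap.finrank_range_add_finrank_ker (restrict C (InClosure C T))
    omega
  interpolate := by
    classical
    intro T' hT' z
    obtain ⟨x, hx, hxz⟩ := interpolate (C := C) (T := T'.map (Function.Embedding.subtype _))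
      (by rw [Finset.card_map]; omega)
      fun i => if hi : InClosure C T i then z ⟨i, hi⟩ else 0
    refine ⟨_, ⟨⟨x, hx⟩, rfl⟩, fun i hi => ?_⟩
    have := hxz i (Finset.mem_map_of_mem _ hi)
    simpa [i.2] using this

lemma finrank_lt_of_dual (hd : 0 < minWeight (dual C)) : finrank F C < n := by
  classical
  obtain ⟨y, hy, hy0, -⟩ := exists_hammingNorm_eq_minWeight hd
  have hC : C ≠ ⊤ := by
    rintro rfl
    refine hy0 (funext fun i => ?_)
    simpa using hy (Pi.single i 1) trivial
  simpa using Submodule.finrank_lt hC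

/-- In a binary code of odd dual distance `d ≥ 5` and length greater than `d`, some `d - 1`
coordinates determine no further coordinate. They are obtained from the support of a minimum
weight dual word by exchanging two coordinates for an outside one: a minimum weight dual word
meeting them in `d - 1` places would be at distance at most four from the first. -/
lemma exists_closed_of_card_eq_two (hq : Nat.card F = 2) (hd : 5 ≤ minWeight (dual C))
    (hn : minWeight (dual C) < n) :
    ∃ T : Finset (Fin n), T.card + 1 = minWeight (dual C) ∧ ∀ i, InClosure C T i → i ∈ T := by
  classical
  obtain ⟨y, hy, hy0, hyw⟩ := exists_hammingNorm_eq_minWeight (C := dual C) (by omega)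
  obtain ⟨S, hS⟩ : ∃ S : Finset (Fin n), S = Finset.univ.filter (y · ≠ 0) := ⟨_, rfl⟩
  have hyS : ∀ i, i ∈ S ↔ y i ≠ 0 := by simp [hS]
  have hSc : S.card = minWeight (dual C) := by
    rw [← hyw, hS]
    exact congrArg Finset.card (by ext; simp)
  obtain ⟨c, hc⟩ : ∃ c, c ∉ S := by
    by_contra! h
    have := Finset.card_le_card (fun j _ => h j : (Finset.univ : Finset (Fin n)) ⊆ S)
    simp only [Finset.card_univ, Fintype.card_fin] at this
    omega
  obtain ⟨a, ha, b, hb, hab⟩ := Finset.one_lt_card.1 (by omega : 1 < S.card)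
  have hbS : b ∈ S.erase a := Finset.mem_erase.2 ⟨hab.symm, hb⟩
  have hcT : c ∉ (S.erase a).erase b := fun h =>
    hc (Finset.mem_of_mem_erase (Finset.mem_of_mem_erase h))
  obtain ⟨T, hT⟩ : ∃ T, T = insert c ((S.erase a).erase b) := ⟨_, rfl⟩
  have hTc : T.card + 1 = minWeight (dual C) := by
    rw [hT, Finset.card_insert_of_notMem hcT, Finset.card_erase_of_mem hbS,
      Finset.card_erase_of_mem ha]
    omega
  refine ⟨T, hTc, fun i hi => ?_⟩
  by_contra hiT
  have hiTc : (insert i T).card = minWeight (dual C) := by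
    rw [Finset.card_insert_of_notMem hiT, hTc]
  rcases interpolate_or_exists_dual C (insert i T) with h | ⟨g, hg, hg0, hgT⟩
  · obtain ⟨x, hx, hxi⟩ := h (Pi.single i 1)
    refine one_ne_zero (α := F) ?_
    rw [← hi x hx fun j hj => ?_, hxi i (by simp), Pi.single_eq_same]
    rw [hxi j (by simp [hj]), Pi.single_eq_of_ne (ne_of_mem_of_not_mem hj hiT)]
  · -- The support of `g` has at least `d` elements, so it is all of `insert i T`.
    have hgne : ∀ j ∈ insert i T, g j ≠ 0 := by
      intro j hj hgj
      have h1 := hammingNorm_le_card (g := g) (T := (insert i T).erase j) fun l hl => by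
        by_cases hlj : l = j
        · rw [hlj, hgj]
        · exact hgT l fun h => hl (Finset.mem_erase.2 ⟨hlj, h⟩)
      have h2 := minWeight_le hg hg0
      rw [Finset.card_erase_of_mem hj] at h1
      omega
    have hcg : g c ≠ 0 := hgne c (by simp [hT])
    have hyc : y c = 0 := by
      by_contra h
      exact hc ((hyS c).2 h)
    have hne : y - g ≠ 0 := fun h => hcg (by simpa [hyc] using congrFun h c)
    have h1 := hammingNorm_le_card (g := y - g) (T := {a, b, c, i}) fun l hl => by
      simp only [Finset.mem_insert, Finset.mem_singleton, not_or] at hl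
      obtain ⟨hla, hlb, hlc, hli⟩ := hl
      by_cases hlS : l ∈ S
      · rw [Pi.sub_apply, eq_one_of_card_eq_two hq ((hyS l).1 hlS),
          eq_one_of_card_eq_two hq (hgne l (by simp [hT, hla, hlb, hlS])), sub_self]
      · have h2 : y l = 0 := by
          by_contra h
          exact hlS ((hyS l).2 h)
        rw [Pi.sub_apply, h2, hgT l (by simp [hT, hlS, hli, hlc]), sub_self]
    have h2 := minWeight_le ((dual C).sub_mem hy hg) hne
    have h3 := Finset.card_le_four (a := a) (b := b) (c := c) (d := i)
    omega

/-- The bound on the covering dimension for dual distance at least four. -/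
lemma exists_covers_of_four_le [Finite F] (hd : 4 ≤ minWeight (dual C))
    (h : ¬ (Nat.card F = 2 ∧ finrank F C + 1 = n ∧ minWeight (dual C) = n ∧ Odd n)) :
    ∃ D ≤ C, Covers D ∧ finrank F D + minWeight (dual C) ≤ finrank F C + 2 := by
  classical
  suffices ∃ T : Finset (Fin n), T.card + 1 = minWeight (dual C) ∧
      ∃ x ∈ C, ∀ i, InClosure C T i → x i ≠ 0 by
    obtain ⟨T, hT, x, hx, hxT⟩ := this
    obtain ⟨D, hD, hcov, hfin⟩ := exists_covers_of_closure (by omega) hx hxT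
    exact ⟨D, hD, hcov, by omega⟩
  have hdn : minWeight (dual C) ≤ n := by
    obtain ⟨y, -, -, hyw⟩ := exists_hammingNorm_eq_minWeight (C := dual C) (by omega)
    rw [← hyw]
    exact hammingNorm_le_card_fintype.trans_eq (Fintype.card_fin n)
  obtain ⟨T, -, hT⟩ := Finset.exists_subset_card_eq (s := (Finset.univ : Finset (Fin n)))
    (n := minWeight (dual C) - 1) (by rw [Finset.card_univ, Fintype.card_fin]; omega)
  by_cases hbin : Nat.card F = 2 ∧ Odd (minWeight (dual C))
  · have hlt : minWeight (dual C) < n := by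
      refine lt_of_le_of_ne hdn fun heq => h ⟨hbin.1, ?_, heq, heq ▸ hbin.2⟩
      have h1 := finrank_ker_restrict (C := C) (T := T) (by omega)
      have h2 := finrank_lt_of_dual (C := C) (by omega)
      omega
    have h5 : 5 ≤ minWeight (dual C) := by
      obtain ⟨l, hl⟩ := hbin.2
      omega
    obtain ⟨T, hT, hcl⟩ := exists_closed_of_card_eq_two hbin.1 h5 hlt
    obtain ⟨x, hx, hx1⟩ := interpolate (C := C) (T := T) (by omega) 1
    exact ⟨T, hT, x, hx, fun i hi => by simp [hx1 i (hcl i hi)]⟩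
  · have hM := isMDS_range_restrict (C := C) (T := T) (by omega)
    rw [not_and_or] at hbin
    obtain ⟨-, ⟨x, rfl⟩, hx⟩ := hM.exists_forall_ne_zero (by omega) (hbin.imp_right fun ho => by
      rw [hT]
      obtain ⟨l, hl⟩ := Nat.not_odd_iff_even.1 ho
      exact ⟨l - 1, by omega⟩)
    exact ⟨T, by omega, x, x.2, fun i hi => hx ⟨i, hi⟩⟩

end Large

/-! ### Dual Hamming codes -/

section Hamming

variable {F : Type*} [Field F] {n : ℕ} {C : Submodule F (Fin n → F)}

/-- Being a dual Hamming code is invariant under isomorphism. -/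
lemma IsDualHamming.of_isomorphic {D : Submodule F (Fin n → F)} (hD : IsDualHamming D)
    (hCD : Isomorphic C D) : IsDualHamming C := by
  obtain ⟨k, G, ⟨hli, hspan⟩, hne, huniq⟩ := hD
  obtain ⟨σ, c, hc⟩ := hCD
  let Φ : (Fin n → F) ≃ₗ[F] (Fin n → F) :=
    { toFun := fun x i => (c i : F) * x (σ i)
      invFun := fun y i => ((c (σ.symm i))⁻¹ : Fˣ) * y (σ.symm i)
      map_add' := fun x y => by ext; simp [mul_add]
      map_smul' := fun a x => by ext; simp [mul_left_comm]
      left_inv := fun x => by ext; simp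
      right_inv := fun x => by ext; simp }
  have hcol : ∀ j, (Matrix.of fun r => Φ.symm (G.row r)).col (σ j) =
      ((c j)⁻¹ : Fˣ) • G.col j := by
    intro j
    ext r
    simp [Φ, Matrix.col_apply, Units.smul_def]
  refine ⟨k, Matrix.of fun r => Φ.symm (G.row r), ⟨?_, ?_⟩, ?_, ?_⟩
  · exact hli.map' Φ.symm.toLinearMap Φ.symm.ker
  · have h1 : Set.range (Matrix.of fun r => Φ.symm (G.row r)).row =
        Φ.symm.toLinearMap '' Set.range G.row := by
      rw [← Set.range_comp]
      rfl
    rw [h1, ← Submodule.map_span, hspan]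
    ext x
    rw [Submodule.mem_map, hc x]
    constructor
    · rintro ⟨y, hy, rfl⟩
      have : Φ (Φ.symm y) ∈ D := by simpa using hy
      exact this
    · exact fun hx => ⟨Φ x, hx, Φ.symm_apply_apply x⟩
  · intro j
    obtain ⟨j, rfl⟩ := σ.surjective j
    rw [hcol, Ne, smul_eq_zero_iff_eq]
    exact hne j
  · intro v hv
    have hiff : ∀ j, (∃ a : F, a ≠ 0 ∧ (Matrix.of fun r => Φ.symm (G.row r)).col (σ j) = a • v) ↔
        ∃ a : F, a ≠ 0 ∧ G.col j = a • v := by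
      intro j
      rw [hcol]
      constructor
      · rintro ⟨a, ha, h⟩
        exact ⟨c j * a, mul_ne_zero (c j).ne_zero ha, by
          rw [mul_smul, ← h, ← Units.smul_def, smul_inv_smul]⟩
      · rintro ⟨a, ha, h⟩
        exact ⟨((c j)⁻¹ : Fˣ) * a, mul_ne_zero (Units.ne_zero _) ha, by
          rw [h, mul_smul, Units.smul_def]⟩
    obtain ⟨j, hj, hju⟩ := huniq v hv
    refine ⟨σ j, (hiff j).2 hj, fun l hl => ?_⟩
    obtain ⟨l, rfl⟩ := σ.surjective l
    rw [hju l ((hiff l).1 hl)]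

lemma isomorphic_refl (C : Submodule F (Fin n → F)) : Isomorphic C C :=
  ⟨1, 1, fun x => by simp⟩

lemma IsGeneratorMatrix.mem_iff {k : ℕ} {G : Matrix (Fin k) (Fin n) F}
    (hG : IsGeneratorMatrix G C) {x : Fin n → F} :
    x ∈ C ↔ ∃ a : Fin k → F, ∀ j, a ⬝ᵥ G.col j = x j := by
  rw [← hG.2, Submodule.mem_span_range_iff_exists_fun]
  refine exists_congr fun a => funext_iff.trans (forall_congr' fun j => ?_)
  simp [dotProduct, Finset.sum_apply, Matrix.row, Matrix.col_apply]

lemma IsGeneratorMatrix.finrank_eq {k : ℕ} {G : Matrix (Fin k) (Fin n) F}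
    (hG : IsGeneratorMatrix G C) : finrank F C = k := by
  rw [← hG.2, finrank_span_eq_card hG.1, Fintype.card_fin]

lemma exists_isGeneratorMatrix (C : Submodule F (Fin n → F)) :
    ∃ G : Matrix (Fin (finrank F C)) (Fin n) F, IsGeneratorMatrix G C := by
  let b := Module.finBasis F C
  refine ⟨Matrix.of fun r => (b r : Fin n → F), ?_, ?_⟩
  · exact b.linearIndependent.map' C.subtype C.ker_subtype
  · have h1 : Set.range (Matrix.of fun r => (b r : Fin n → F)).row =
        C.subtype '' Set.range b := by
      rw [← Set.range_comp]
      rfl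
    rw [h1, ← Submodule.map_span, b.span_eq, Submodule.map_top, Submodule.range_subtype]

/-- Linear dependencies among the columns of a generator matrix are dual words. -/
lemma IsGeneratorMatrix.mem_dual {k : ℕ} {G : Matrix (Fin k) (Fin n) F}
    (hG : IsGeneratorMatrix G C) {g : Fin n → F} (h : ∑ j, g j • G.col j = 0) : g ∈ dual C := by
  intro x hx
  obtain ⟨a, ha⟩ := hG.mem_iff.1 hx
  have : x ⬝ᵥ g = a ⬝ᵥ ∑ j, g j • G.col j := by
    rw [dotProduct_sum, dotProduct]
    exact Finset.sum_congr rfl fun j _ => by rw [dotProduct_smul, ha, smul_eq_mul, mul_comm]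
  rw [this, h, dotProduct_zero]

/-- Any `d - 1` columns of a generator matrix are independent, where `d` is the dual distance. -/
lemma IsGeneratorMatrix.eq_zero_of_sum {k : ℕ} {G : Matrix (Fin k) (Fin n) F}
    (hG : IsGeneratorMatrix G C) {T : Finset (Fin n)} (hT : T.card < minWeight (dual C))
    {g : Fin n → F} (hgT : ∀ i, i ∉ T → g i = 0) (h : ∑ j, g j • G.col j = 0) : g = 0 := by
  by_contra hg
  have h1 := minWeight_le (hG.mem_dual h) hg
  have h2 := hammingNorm_le_card hgT
  omega

/-- Either the columns of a generator matrix represent every point of the projective space, or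
the hyperplane of `C` given by a missed point is a covering subcode. -/
lemma isDualHamming_or_exists_covers (hd : 3 ≤ minWeight (dual C)) :
    IsDualHamming C ∨ ∃ D ≤ C, Covers D ∧ finrank F D + 1 ≤ finrank F C := by
  classical
  obtain ⟨G, hG⟩ := exists_isGeneratorMatrix C
  have hne : ∀ j, G.col j ≠ 0 := by
    intro j hj
    have := hG.eq_zero_of_sum (T := {j}) (g := Pi.single j 1) (by rw [Finset.card_singleton]; omega)
      (fun i hi => Pi.single_eq_of_ne (by simpa using hi) _) (by
        rw [Finset.sum_eq_single j (fun i _ hi => by simp [hi]) (by simp)]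
        simp [hj])
    simpa using congrFun this j
  have hpair : ∀ i j (a : F), G.col i = a • G.col j → i = j := by
    intro i j a hij
    by_contra hne'
    have := hG.eq_zero_of_sum (T := {i, j}) (g := Pi.single i 1 - Pi.single j a)
      (lt_of_le_of_lt Finset.card_le_two (by omega))
      (fun l hl => by
        simp only [Finset.mem_insert, Finset.mem_singleton, not_or] at hl
        simp [hl.1, hl.2]) (by
        simp only [Pi.sub_apply, sub_smul, Finset.sum_sub_distrib]
        rw [Finset.sum_eq_single i (fun l _ hl => by simp [hl]) (by simp),
          Finset.sum_eq_single j (fun l _ hl => by simp [hl]) (by simp)]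
        simp [hij])
    simpa [hne'] using congrFun this i
  by_cases hall : ∀ v : Fin (finrank F C) → F, v ≠ 0 → ∃ j, ∃ c : F, c ≠ 0 ∧ G.col j = c • v
  · refine Or.inl ⟨_, G, hG, hne, fun v hv => ?_⟩
    obtain ⟨j, c, hc, hj⟩ := hall v hv
    refine ⟨j, ⟨c, hc, hj⟩, ?_⟩
    rintro i ⟨c', -, hi⟩
    refine hpair i j (c' * c⁻¹) ?_
    rw [hi, hj, smul_smul, inv_mul_cancel_right₀ hc]
  · right
    push Not at hall
    obtain ⟨v, hv, hvj⟩ := hall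
    -- The words `a ᵥ* G` with `a` orthogonal to `v`.
    let K := LinearMap.ker (dotProductBilin F F v)
    have hK : K ≠ ⊤ := fun h => hv (dotProduct_eq_zero v fun w =>
      (LinearMap.mem_ker (f := dotProductBilin F F v)).1 (show w ∈ K from h ▸ Submodule.mem_top))
    refine ⟨K.map (Matrix.vecMulLinear G), ?_, fun j => ?_, ?_⟩
    · rintro _ ⟨a, -, rfl⟩
      exact hG.mem_iff.2 ⟨a, fun j => rfl⟩
    · by_contra! h
      obtain ⟨i, hi⟩ := Function.ne_iff.1 hv
      have hl : ∀ l, v i * G l j = v l * G i j := by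
        intro l
        have h1 := h _ ⟨v i • Pi.single l 1 - v l • Pi.single i 1, by
          simp [K, mul_comm], rfl⟩
        have h2 : (v i • Pi.single l 1 - v l • Pi.single i 1) ⬝ᵥ G.col j = 0 := h1
        simpa [sub_eq_zero] using h2
      have hcol : G.col j = (G i j / v i) • v := by
        ext l
        have := hl l
        rw [Pi.zero_apply] at hi
        simp only [Matrix.col_apply, Pi.smul_apply, smul_eq_mul]
        field_simp
        linear_combination this
      refine hvj j _ (fun h0 => hne j ?_) hcol
      rw [hcol, h0, zero_smul]
    · have h1 := Submodule.finrank_map_le (Matrix.vecMulLinear G) K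
      have h2 := Submodule.finrank_lt hK
      rw [Module.finrank_fin_fun] at h2
      omega

/-- A dual Hamming code with dual distance at least three has dual distance three and no proper
covering subcode. -/
lemma IsDualHamming.minWeight_and_covers (hC : IsDualHamming C) (hd : 3 ≤ minWeight (dual C)) :
    minWeight (dual C) = 3 ∧ ∀ D ≤ C, Covers D → D = C := by
  classical
  obtain ⟨k, G, hG, hne, huniq⟩ := hC
  refine ⟨le_antisymm ?_ hd, fun D hDC hD => ?_⟩
  · have hn : 3 ≤ n := by
      obtain ⟨y, -, -, hyw⟩ := exists_hammingNorm_eq_minWeight (C := dual C) (by omega)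
      exact (hd.trans hyw.ge).trans (hammingNorm_le_card_fintype.trans_eq (Fintype.card_fin n))
    -- A column proportional to the sum of two others gives a dual word of weight three.
    obtain ⟨j₀, j₁, hj⟩ : ∃ j₀ j₁ : Fin n, j₀ ≠ j₁ :=
      ⟨⟨0, by omega⟩, ⟨1, by omega⟩, by simp⟩
    have hsum : G.col j₀ + G.col j₁ ≠ 0 := by
      intro h
      refine hj ((huniq _ (hne j₀)).unique ⟨1, one_ne_zero, (one_smul F _).symm⟩
        ⟨-1, by simp, ?_⟩)
      rw [neg_one_smul]
      exact (neg_eq_of_add_eq_zero_right h).symm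
    obtain ⟨j₂, ⟨c, hc, hj₂⟩, -⟩ := huniq _ hsum
    have hg : (Pi.single j₂ 1 - Pi.single j₀ c - Pi.single j₁ c : Fin n → F) ∈ dual C := by
      refine hG.mem_dual ?_
      simp only [Pi.sub_apply, sub_smul, Finset.sum_sub_distrib]
      rw [Finset.sum_eq_single j₂ (fun l _ hl => by simp [hl]) (by simp),
        Finset.sum_eq_single j₀ (fun l _ hl => by simp [hl]) (by simp),
        Finset.sum_eq_single j₁ (fun l _ hl => by simp [hl]) (by simp)]
      simp [hj₂]
    refine (minWeight_le hg fun h0 => ?_).trans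
      ((hammingNorm_le_card (T := {j₀, j₁, j₂}) fun l hl => ?_).trans Finset.card_le_three)
    · by_cases h : j₂ = j₁
      · have := congrFun h0 j₀
        simp [h, hj, hc] at this
      · have := congrFun h0 j₁
        simp [Ne.symm h, hj.symm, hc] at this
    · simp only [Finset.mem_insert, Finset.mem_singleton, not_or] at hl
      simp [hl.1, hl.2.1, hl.2.2]
  · -- A functional vanishing on a proper subcode is a multiple of some coordinate.
    by_contra hne'
    have hlt : D.comap (Matrix.vecMulLinear G) < ⊤ := by
      refine lt_top_iff_ne_top.2 fun h => hne' (le_antisymm hDC fun x hx => ?_)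
      obtain ⟨a, ha⟩ := hG.mem_iff.1 hx
      have h1 : a ∈ D.comap (Matrix.vecMulLinear G) := h ▸ Submodule.mem_top
      have h2 : Matrix.vecMulLinear G a = x := funext ha
      rwa [Submodule.mem_comap, h2] at h1
    obtain ⟨φ, hφ, hle⟩ := Submodule.exists_le_ker_of_lt_top _ hlt
    have hφv : ∀ a, φ a = a ⬝ᵥ fun i => φ (Pi.single i 1) := by
      intro a
      rw [LinearMap.pi_apply_eq_sum_univ φ a, dotProduct]
      refine Finset.sum_congr rfl fun i _ => ?_
      rw [smul_eq_mul]
      congr 2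
      ext j
      simp [Pi.single_apply, eq_comm]
    obtain ⟨j, ⟨c, -, hj⟩, -⟩ := huniq (fun i => φ (Pi.single i 1)) fun h => hφ (by
      ext i
      simpa using congrFun h i)
    obtain ⟨x, hx, hxj⟩ := hD j
    obtain ⟨a, ha⟩ := hG.mem_iff.1 (hDC hx)
    have h2 : Matrix.vecMulLinear G a = x := funext ha
    have h3 : φ a = 0 := hle (show Matrix.vecMulLinear G a ∈ D from h2 ▸ hx)
    refine hxj ?_
    rw [← ha j, hj, dotProduct_smul, ← hφv, h3, smul_zero]

end Hamming

/-! ### The binary even weight codes of odd length -/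

section EvenWeight

variable {F : Type*} [Field F] {n : ℕ} {C : Submodule F (Fin n → F)}

/-- A code in which any `n - 1` coordinates can be prescribed contains, for each coordinate, a word
equal to one elsewhere; two of these words cover all coordinates. -/
lemma exists_covers_finrank_le_two (hd : minWeight (dual C) = n)
    (hn : 3 ≤ n) : ∃ D ≤ C, Covers D ∧ finrank F D ≤ 2 := by
  classical
  have hone : ∀ i : Fin n, ∃ x ∈ C, ∀ j ∈ Finset.univ.erase i, x j = 1 := fun i =>
    interpolate (by
      rw [Finset.card_erase_of_mem (Finset.mem_univ i), Finset.card_univ, Fintype.card_fin, hd]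
      omega) 1
  choose x hx hx1 using hone
  let i₀ : Fin n := ⟨0, by omega⟩
  let i₁ : Fin n := ⟨1, by omega⟩
  have h01 : i₀ ≠ i₁ := by simp [i₀, i₁]
  refine ⟨Submodule.span F {x i₀, x i₁}, ?_, fun i => ?_, ?_⟩
  · rw [Submodule.span_le]
    rintro y (rfl | rfl)
    · exact hx i₀
    · exact hx i₁
  · by_cases h : i = i₀
    · exact ⟨x i₁, Submodule.subset_span (by simp), by simp [hx1 i₁ i (by simp [h, h01])]⟩
    · exact ⟨x i₀, Submodule.subset_span (by simp), by simp [hx1 i₀ i (by simp [h])]⟩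
  · refine (finrank_span_le_card (R := F) ({x i₀, x i₁} : Set (Fin n → F))).trans ?_
    simpa using Finset.card_le_two (a := x i₀) (b := x i₁)

/-- The dual contains the all-ones word, of odd weight, so the code itself does not contain it. -/
lemma two_le_finrank_of_covers (hq : Nat.card F = 2) (hd : minWeight (dual C) = n)
    (hn : 0 < n) (hodd : Odd n) {D : Submodule F (Fin n → F)} (hDC : D ≤ C) (hD : Covers D) :
    2 ≤ finrank F D := by
  classical
  by_contra! hlt
  obtain ⟨⟨x, hxD⟩, hx⟩ := finrank_le_one_iff.1 (Nat.le_of_lt_succ hlt)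
  have hx1 : ∀ i, x i = 1 := by
    intro i
    obtain ⟨y, hy, hyi⟩ := hD i
    obtain ⟨c, hc⟩ := hx ⟨y, hy⟩
    have : c * x i = y i := congrFun (congrArg Subtype.val hc) i
    exact eq_one_of_card_eq_two hq (right_ne_zero_of_mul (this.trans_ne hyi))
  obtain ⟨g, hg, hg0, hgw⟩ := exists_hammingNorm_eq_minWeight (C := dual C) (by omega)
  have hg1 : ∀ i, g i = 1 := by
    intro i
    refine eq_one_of_card_eq_two hq fun hi => ?_
    have h1 := hammingNorm_le_card (g := g) (T := Finset.univ.erase i) fun l hl => by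
      have : l = i := by simpa using hl
      rw [this, hi]
    rw [Finset.card_erase_of_mem (Finset.mem_univ i), Finset.card_univ, Fintype.card_fin] at h1
    omega
  have h0 := hg x (hDC hxD)
  obtain ⟨l, rfl⟩ := hodd
  have h2 := natCast_eq_zero_of_even hq (even_two_mul l)
  push_cast at h2
  simp [dotProduct, hx1, hg1, h2] at h0

end EvenWeight

end LinCode

theorem mainTheorem3 {F : Type*} [Field F] [Finite F] (n k d : ℕ)
    (C : Submodule F (Fin n → F)) (hk : Module.finrank F C = k)
    (hd : LinCode.minWeight (LinCode.dual C) = d) (hd3 : 3 ≤ d)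
    (hq : ¬ ((∃ m : ℕ, 2 ≤ m ∧ Nat.card F = 2 ^ m) ∧ 4 < d)) :
    (¬ LinCode.IsExceptional C →
      ∃ r : ℕ, LinCode.coveringDim C = r ∧ (r : ℤ) ≤ (k : ℤ) - d + 2) ∧
    (LinCode.IsExceptional C →
      ∃ r : ℕ, LinCode.coveringDim C = r ∧ (r : ℤ) = (k : ℤ) - d + 3) := by
  have hn : 0 < n := by
    have := LinCode.finrank_lt_of_dual (C := C) (by omega)
    omega
  constructor
  · intro hex
    rw [LinCode.IsExceptional, not_or] at hex
    obtain ⟨D, hDC, hD, hfin⟩ : ∃ D ≤ C, LinCode.Covers D ∧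
        finrank F D + LinCode.minWeight (LinCode.dual C) ≤ finrank F C + 2 := by
      by_cases h4 : 4 ≤ d
      · exact LinCode.exists_covers_of_four_le (by omega) hex.2
      · rcases LinCode.isDualHamming_or_exists_covers (C := C) (by omega) with h | ⟨D, h1, h2, h3⟩
        · exact absurd ⟨C, h, LinCode.isomorphic_refl C⟩ hex.1
        · exact ⟨D, h1, h2, by omega⟩
    obtain ⟨D', -, -, h1, h2⟩ := hD.exists_coveringDim_eq hn hDC
    exact ⟨_, h1, by omega⟩
  · rintro (⟨D, hD, hCD⟩ | ⟨hq2, hkn, hdn, hodd⟩)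
    · obtain ⟨hd', hmin⟩ := (hD.of_isomorphic hCD).minWeight_and_covers (by omega)
      have hC : LinCode.Covers C := by
        intro i
        obtain ⟨x, hx, hxi⟩ := LinCode.interpolate (C := C) (T := {i})
          (by rw [Finset.card_singleton]; omega) 1
        exact ⟨x, hx, by simp [hxi i]⟩
      obtain ⟨D', hD'C, hD', h1, -⟩ := hC.exists_coveringDim_eq hn le_rfl
      rw [hmin D' hD'C hD'] at h1
      exact ⟨_, h1, by omega⟩
    · obtain ⟨D, hDC, hD, hfin⟩ := LinCode.exists_covers_finrank_le_two hdn (by omega)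
      obtain ⟨D', hD'C, hD', h1, h2⟩ := hD.exists_coveringDim_eq hn hDC
      have := LinCode.two_le_finrank_of_covers hq2 hdn hn hodd hD'C hD'
      exact ⟨_, h1, by omega⟩
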